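/- Let $B,D\ge 1$ and $C,S,K,W,Q\ge 0$ be integers and let $N=BD$. The Stash Shuffle with these parameters takes an array of $N$ distinct items, viewed as $B$ consecutive input buckets of $D$ items each, and works as follows. *Random choices.* Every item independently chooses a uniformly random target among the $B$ output buckets. Independently of this and of each other, $B$ uniformly random permutations of $CB+K$ slots are chosen, one for every output bucket. *Distribution phase.* The intermediate array consists of $B$ buckets, initially empty, and the stash consists of $B$ first-in-first-out queues, one for each output bucket, initially empty. The input buckets are processed in order. For each of them, a new chunk of capacity $C$ is opened for every output bucket $j$; items are moved from the $j$-th stash queue into the $j$-th chunk as long as the queue is nonempty and the chunk is not full. Then each of the $D$ items in order, with target $j$, is put into the $j$-th chunk if this is not full; otherwise it is put into the $j$-th stash queue if the stash contains fewer than $S$ items in total; otherwise the shuffle fails. Finally the chunks are padded with dummies to exactly $C$ slots and appended to the corresponding intermediate buckets. After the last input bucket, up to $K$ items of each stash queue are appended, padded with dummies to exactly $K$ slots, to the corresponding intermediate bucket, and the shuffle fails if the stash is then nonempty. *Compression phase.* Let $L=\min(W,B)$. To read an intermediate bucket means to permute its $CB+K$ slots by its random permutation, to discard the dummies, and to append the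 remaining items in order to a queue. To write an output bucket means to move $D$ items from the front of the queue to the end of the output array; the shuffle fails if there are fewer than $D$ items in the queue. The first $L$ intermediate buckets are read; then, in each of the next $B-L$ iterations, the next intermediate bucket is read and one output bucket is written; then the last $L$ output buckets are written. The shuffle fails if more than $WD+Q$ items are in the queue after one of the first $L$ reads or at the end of one of the $B-L$ iterations. (So, if $Y_i$ is the number of items in the first $i$ intermediate buckets, the compression phase fails for $1\le W\le B$ exactly if $0\le Y_i-D(i-W)\le WD+Q$ is violated for some $W\le i\le B$.) The output is the output array, or the symbol $\bot$ if the shuffle fails. **Theorem.** Put $t=CB/D-1$ and assume that $K\ge S/B>2C$, $W\le B$ and $$e^{t}<1+(tC-\ln 2)\,\frac{B}{D}.$$ Then, for every input array of $N$ distinct items, the statistical (total variation) distance between the distribution of the output of the Stash Shuffle and the uniform distribution on the $N!$ arrangements of the items is at most $$B^2\exp\left\{(CB/D-1)(2C-S/B)\right\}+B\left\{\exp\left(-\frac{2(DW)^2}{N}\right)+\exp\left(-\frac{2Q^2}{N}\right)\right\}.$$ -/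

import Mathlib

namespace StashShuffle

/-- Parameters: `B` buckets of `D` items each, quota `C` per (input bucket, output bucket) pair,
total stash capacity `S`, `K` extra slots per output bucket for the final stash drain,
window size `W`, queue slack `Q`. -/
structure Params where
  B : ℕ
  D : ℕ
  C : ℕ
  S : ℕ
  K : ℕ
  W : ℕ
  Q : ℕ

/-- The number of items, `N = B * D`. -/
abbrev Params.N (P : Params) : ℕ := P.B * P.D

/-- Number of slots of an intermediate bucket: `C` per input bucket and `K` for the drain. -/
abbrev Params.slots (P : Params) : ℕ := P.C * P.B + P.K

/-- `dataIdx b i = b * D + i`: the position of the `i`-th item of the `b`-th input bucket. -/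
def Params.dataIdx (P : Params) (b : Fin P.B) (i : Fin P.D) : Fin P.N :=
  finProdFinEquiv (b, i)

/-- The contents `output` (of the chunks to be written, one per output bucket) and `stash`
(one FIFO queue per output bucket) of private memory during the distribution of one bucket. -/
structure ChunkState (P : Params) (α : Type*) where
  output : Fin P.B → List α
  stash : Fin P.B → List α

/-- State between two steps of the distribution phase: the intermediate array, in which `none` is
a dummy, and the stash. -/
structure DistState (P : Params) (α : Type*) where
  mid : Fin P.B → List (Option α)
  stash : Fin P.B → List α

/-- A chunk padded with dummies up to `n` slots. -/
def pad {α : Type*} (n : ℕ) (l : List α) : List (Option α) :=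
  l.map some ++ List.replicate (n - l.length) none

section Algorithm

variable {α : Type*} (P : Params)

/-- Move stashed items into empty chunks of size `n`, while there is room and there are items. -/
def unstash (n : ℕ) (stash : Fin P.B → List α) : ChunkState P α where
  output := fun j => (stash j).take n
  stash := fun j => (stash j).drop n

/-- Put one item with target `j` in its chunk if that has fewer than `C` items, otherwise in
the stash if that holds fewer than `S` items in total, and otherwise fail. -/
def placeItem (s : ChunkState P α) (j : Fin P.B) (x : α) : Option (ChunkState P α) :=
  if (s.output j).length < P.C then
    some { s with output := Function.update s.output j (s.output j ++ [x]) }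
  else if ∑ k, (s.stash k).length < P.S then
    some { s with stash := Function.update s.stash j (s.stash j ++ [x]) }
  else none

/-- Distribute one input bucket with the given items and targets; every output bucket of the
intermediate array receives a chunk of exactly `C` slots. -/
def distributeBucket (targets : Fin P.D → Fin P.B) (items : Fin P.D → α) (s : DistState P α) :
    Option (DistState P α) :=
  ((List.finRange P.D).foldlM (fun c i => placeItem P c (targets i) (items i))
      (unstash P P.C s.stash)).map fun c =>
    { mid := fun j => s.mid j ++ pad P.C (c.output j)
      stash := c.stash }

/-- The final drain of the stash, `K` slots per output bucket; it fails if items are left. -/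
def drainStash (s : DistState P α) : Option (Fin P.B → List (Option α)) :=
  let c := unstash P P.K s.stash
  if ∀ j, c.stash j = [] then some fun j => s.mid j ++ pad P.K (c.output j) else none

/-- The distribution phase: all input buckets in turn, then the drain of the stash. -/
def distribute (targets : Fin P.B → Fin P.D → Fin P.B) (input : Fin P.N → α) :
    Option (Fin P.B → List (Option α)) :=
  ((List.finRange P.B).foldlM
      (fun s b => distributeBucket P (targets b) (fun i => input (P.dataIdx b i)) s)
      { mid := fun _ => [], stash := fun _ => [] }).bind (drainStash P)

/-- Permute the slots of an intermediate bucket (dummies included) by `σ`, then throw away the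
dummies. Intermediate buckets always have exactly `P.slots` slots. -/
def shuffleBucket (σ : Equiv.Perm (Fin P.slots)) (bucket : List (Option α)) : List α :=
  (List.ofFn fun i => bucket.getD (σ i) none).reduceOption

/-- State of the compression phase: the queue in private memory and the output written so far. -/
structure CompState (α : Type*) where
  queue : List α
  out : List α

/-- Enqueue the real items of an intermediate bucket. -/
def importBucket (bucket : List α) (s : CompState α) : CompState α :=
  { s with queue := s.queue ++ bucket }

/-- Write `D` items from the front of the queue as the next output bucket; fail on underflow. -/
def drainQueue (s : CompState α) : Option (CompState α) :=
  if s.queue.length < P.D then none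
  else some { queue := s.queue.drop P.D, out := s.out ++ s.queue.take P.D }

/-- Fail if more than `W * D + Q` items are kept in the queue. -/
def checkQueue (s : CompState α) : Option (CompState α) :=
  if s.queue.length ≤ P.W * P.D + P.Q then some s else none

/-- The compression phase, on intermediate buckets already shuffled and freed of dummies, with
effective window `L = min W B`. The first `L` buckets are read into the queue. Then, in each of
the next `B - L` iterations, the next bucket is read and one output bucket is written. Finally
the last `L` output buckets are written. Between iterations at most `W * D + Q` items may be
kept. So after `i ≥ L` buckets with `Y i` items in all have been read, `i - L` output buckets
have been written, and failure means that `0 ≤ Y i - D * (i - L) ≤ W * D + Q` is violated. -/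
def compress (bucket : Fin P.B → List α) : Option (List α) :=
  let L := min P.W P.B
  let idx := List.finRange P.B
  do
    let s₁ ← (idx.take L).foldlM (fun s b => checkQueue P (importBucket (bucket b) s))
      { queue := [], out := [] }
    let s₂ ← (idx.drop L).foldlM
      (fun s b => (drainQueue P (importBucket (bucket b) s)).bind (checkQueue P)) s₁
    let s₃ ← (idx.drop (P.B - L)).foldlM (fun s _ => drainQueue P s) s₂
    return s₃.out

/-- The random choices: a target bucket for every item of every input bucket, and a permutation of
the slots of every intermediate bucket. -/
abbrev Coins : Type :=
  (Fin P.B → Fin P.D → Fin P.B) × (Fin P.B → Equiv.Perm (Fin P.slots))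

instance : Nonempty (Coins P) :=
  ⟨(fun b _ => b, fun _ => 1)⟩

/-- The Stash Shuffle as a function of its random choices and its input array. The value is the
output array, or `none` if the shuffle fails. -/
def run (ω : Coins P) (input : Fin P.N → α) : Option (List α) :=
  (distribute P ω.1 input).bind fun mid => compress P fun j => shuffleBucket P (ω.2 j) (mid j)

/-- The distribution of the output of the Stash Shuffle; all random choices are uniform and
independent. -/
noncomputable def outputDist (input : Fin P.N → α) : PMF (Option (List α)) :=
  (PMF.uniformOfFintype (Coins P)).map fun ω => run P ω input

end Algorithm

/-- The uniform distribution on the arrangements of the items `0, …, n - 1` in an array (an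
ideal shuffle, which never fails). -/
noncomputable def uniformDist (n : ℕ) : PMF (Option (List (Fin n))) :=
  (PMF.uniformOfFintype (Equiv.Perm (Fin n))).map fun π => some (List.ofFn fun i => π i)

/-- Statistical (total variation) distance: the supremum over all events `A` of
`|p A - q A|`. -/
noncomputable def statDist {β : Type*} (p q : PMF β) : ℝ :=
  ⨆ A : Set β, |(p.toOuterMeasure A).toReal - (q.toOuterMeasure A).toReal|

end StashShuffle

/-! The distance is at most the probability of failure: every array other than `⊥` is output with
probability at most its uniform mass, so the excess of the first distribution over the second sits
on `⊥` alone (`statDist_le_of_le_of_ne`).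

Fix an array `l`. On success the output is the concatenation of the shuffled intermediate buckets,
and bucket `j` holds exactly the items with target `j`. Hence `l` and the bucket sizes `n_j`
determine all targets (`targets_eq_of_run`), and for given targets at most a fraction `1 / ∏ n_j!`
of the slot permutations yields `l` (`card_run_eq_some_mul_le`). Size vectors being distinct,
summing over them gives multinomial coefficients divided by `N!`, with total at most `B^N / N!`; so
`l` has probability at most `1 / N!` (`card_run_mul_factorial_le`).

Failure is controlled by the targets alone. The stash suffices if each queue, run without a capacity
limit, stays below `S / B`. Such a queue obeys `q ↦ max (q + X - C) 0`, so `exp (t q)` is at most a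
sum of products of independent weights `exp (t (X - C))`. The condition on `e^t` makes each weight
have mean at most `1/2`, the geometric series gives mean at most `2`, and Markov's inequality
finishes (`card_queueLen_ge_le`). The compression queue is controlled by Hoeffding's inequality for
the number of items in the first `i` buckets (`card_hits_ge_le`). A union bound adds these up.
Probabilities appear throughout as counts of coins. -/

namespace StashShuffle

/-! ### Invariants of folds that may fail -/

section Folds

variable {σ β : Type*}

theorem foldlM_invariant (f : σ → β → Option σ) (l : List β) (Inv : ℕ → σ → Prop)
    (step : ∀ k (hk : k < l.length) s s', Inv k s → f s l[k] = some s' → Inv (k + 1) s')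
    {s₀ s₁ : σ} (h₀ : Inv 0 s₀) (h : l.foldlM f s₀ = some s₁) : Inv l.length s₁ := by
  induction l generalizing Inv s₀ with
  | nil => simp at h; simpa [← h] using h₀
  | cons a l ih =>
    rw [List.foldlM_cons] at h
    obtain ⟨s', hs', h⟩ := Option.bind_eq_some_iff.1 h
    refine ih (fun k s => Inv (k + 1) s) (fun k hk s s' hi hf => ?_)
      (step 0 (by simp) _ _ h₀ hs') h
    exact step (k + 1) (by simpa using hk) s s' hi (by simpa using hf)

theorem foldlM_succeeds (f : σ → β → Option σ) (l : List β) (Inv : ℕ → σ → Prop)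
    (step : ∀ k (hk : k < l.length) s, Inv k s → ∃ s', f s l[k] = some s' ∧ Inv (k + 1) s')
    {s₀ : σ} (h₀ : Inv 0 s₀) : ∃ s₁, l.foldlM f s₀ = some s₁ ∧ Inv l.length s₁ := by
  induction l generalizing Inv s₀ with
  | nil => exact ⟨s₀, rfl, h₀⟩
  | cons a l ih =>
    obtain ⟨s', hs', hi⟩ := step 0 (by simp) _ h₀
    obtain ⟨s₁, h, hi₁⟩ := ih (fun k s => Inv (k + 1) s) (fun k hk s hi =>
      step (k + 1) (Nat.succ_lt_succ hk) s hi) hi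
    refine ⟨s₁, ?_, hi₁⟩
    rw [List.foldlM_cons]
    exact Option.bind_eq_some_iff.2 ⟨s', hs', h⟩

end Folds

/-! ### The distribution phase: contents of the buckets and sufficient room -/

section Distribution

variable {α : Type*} (P : Params)

/-- The items of one input bucket with target `j`, in order, among the first `k` items. -/
def itemsFor (τ : Fin P.D → Fin P.B) (x : Fin P.D → α) (j : Fin P.B) (k : ℕ) : List α :=
  (((List.finRange P.D).take k).filter (fun i => τ i = j)).map x

/-- The number of items of one input bucket with target `j`. -/
def targetCount (τ : Fin P.D → Fin P.B) (j : Fin P.B) : ℕ :=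
  (Finset.univ.filter fun i => τ i = j).card

theorem itemsFor_zero (τ : Fin P.D → Fin P.B) (x : Fin P.D → α) (j : Fin P.B) :
    itemsFor P τ x j 0 = [] := by simp [itemsFor]

theorem itemsFor_succ (τ : Fin P.D → Fin P.B) (x : Fin P.D → α) (j : Fin P.B) {k : ℕ}
    (hk : k < P.D) :
    itemsFor P τ x j (k + 1) =
      itemsFor P τ x j k ++ if τ ⟨k, hk⟩ = j then [x ⟨k, hk⟩] else [] := by
  have h : (List.finRange P.D).take (k + 1) = (List.finRange P.D).take k ++ [⟨k, hk⟩] := by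
    rw [← List.take_concat_get' _ k (by simpa using hk)]; simp
  rw [itemsFor, h, List.filter_append, List.map_append, ← itemsFor]
  congr 1
  by_cases hj : τ ⟨k, hk⟩ = j <;> simp [hj]

theorem itemsFor_length (τ : Fin P.D → Fin P.B) (x : Fin P.D → α) (j : Fin P.B) :
    (itemsFor P τ x j P.D).length = targetCount P τ j := by
  have h : (List.finRange P.D).take P.D = List.finRange P.D :=
    List.take_of_length_le (by simp)
  rw [itemsFor, h, List.length_map, targetCount, ← List.toFinset_card_of_nodup
    ((List.nodup_finRange _).filter _)]
  congr 1
  ext i; simp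

theorem itemsFor_length_le (τ : Fin P.D → Fin P.B) (x : Fin P.D → α) (j : Fin P.B) (k : ℕ) :
    (itemsFor P τ x j k).length ≤ targetCount P τ j := by
  rw [← itemsFor_length P τ x j, itemsFor, itemsFor, List.length_map, List.length_map]
  refine List.Sublist.length_le (List.Sublist.filter _ ?_)
  rw [List.take_of_length_le (i := P.D) (by simp)]
  exact List.take_sublist _ _

/-- No chunk is over capacity, and only items whose chunk is full are in the stash. -/
def ChunkState.Wf {P : Params} (c : ChunkState P α) : Prop :=
  ∀ j, (c.output j).length ≤ P.C ∧ ((c.output j).length < P.C → c.stash j = [])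

theorem unstash_wf (st : Fin P.B → List α) : (unstash P P.C st).Wf := by
  intro j
  simp only [unstash, List.length_take, List.drop_eq_nil_iff]
  omega

theorem unstash_append (n : ℕ) (st : Fin P.B → List α) (j : Fin P.B) :
    (unstash P n st).output j ++ (unstash P n st).stash j = st j := by
  simp [unstash]

variable {P}

/-- The split between chunk and stash depends only on the total length. Truncated subtraction is the
`max · 0` of the queue recursion. -/
theorem ChunkState.Wf.stash_length {c : ChunkState P α} (hc : c.Wf) (j : Fin P.B) :
    (c.stash j).length = (c.output j ++ c.stash j).length - P.C := by
  obtain ⟨h₁, h₂⟩ := hc j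
  rw [List.length_append]
  rcases h₁.lt_or_eq with h | h
  · rw [h₂ h]; simp; omega
  · omega

/-- First-in-first-out order survives because a chunk with room has an empty stash queue: an item
put in the chunk overtakes nothing. -/
theorem placeItem_spec {c c' : ChunkState P α} (hc : c.Wf) {j : Fin P.B} {x : α}
    (h : placeItem P c j x = some c') :
    c'.Wf ∧ ∀ k, c'.output k ++ c'.stash k =
      (c.output k ++ c.stash k) ++ if j = k then [x] else [] := by
  unfold placeItem at h
  split_ifs at h with h₁ h₂
  · obtain rfl := Option.some.inj h
    refine ⟨fun k => ?_, fun k => ?_⟩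
    · by_cases hk : k = j
      · subst hk
        simp only [Function.update_self, List.length_append, List.length_singleton]
        exact ⟨by omega, fun _ => (hc k).2 h₁⟩
      · simpa [Function.update_of_ne hk] using hc k
    · by_cases hk : k = j
      · subst hk
        simp [(hc k).2 h₁]
      · simp [Function.update_of_ne hk, Ne.symm hk]
  · obtain rfl := Option.some.inj h
    refine ⟨fun k => ?_, fun k => ?_⟩
    · by_cases hk : k = j
      · subst hk
        exact ⟨(hc k).1, fun h => absurd h h₁⟩
      · simpa only [Function.update_of_ne hk] using hc k
    · by_cases hk : k = j
      · subst hk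
        simp
      · simp [Function.update_of_ne hk, Ne.symm hk]

theorem placeItem_isSome {c : ChunkState P α} (h : ∑ k, (c.stash k).length < P.S)
    (j : Fin P.B) (x : α) : ∃ c', placeItem P c j x = some c' := by
  unfold placeItem
  split_ifs
  · exact ⟨_, rfl⟩
  · exact ⟨_, rfl⟩

/-- What is known of the chunks and the stash after `k` items of an input bucket. -/
def ChunkState.Placed (c : ChunkState P α) (st : Fin P.B → List α) (τ : Fin P.D → Fin P.B)
    (x : Fin P.D → α) (k : ℕ) : Prop :=
  c.Wf ∧ ∀ j, c.output j ++ c.stash j = st j ++ itemsFor P τ x j k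

theorem unstash_placed (st : Fin P.B → List α) (τ : Fin P.D → Fin P.B) (x : Fin P.D → α) :
    (unstash P P.C st).Placed st τ x 0 :=
  ⟨unstash_wf P st, fun j => by rw [unstash_append, itemsFor_zero, List.append_nil]⟩

theorem ChunkState.Placed.step {c c' : ChunkState P α} {st : Fin P.B → List α}
    {τ : Fin P.D → Fin P.B} {x : Fin P.D → α} {k : ℕ} (hc : c.Placed st τ x k) (hk : k < P.D)
    (h : placeItem P c (τ ⟨k, hk⟩) (x ⟨k, hk⟩) = some c') : c'.Placed st τ x (k + 1) := by
  obtain ⟨h₁, h₂⟩ := placeItem_spec hc.1 h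
  exact ⟨h₁, fun j => by rw [h₂, hc.2, itemsFor_succ P τ x j hk, List.append_assoc]⟩

theorem ChunkState.Placed.stash_length {c : ChunkState P α} {st : Fin P.B → List α}
    {τ : Fin P.D → Fin P.B} {x : Fin P.D → α} {k : ℕ} (hc : c.Placed st τ x k) (j : Fin P.B) :
    (c.stash j).length = (st j).length + (itemsFor P τ x j k).length - P.C := by
  rw [hc.1.stash_length, hc.2, List.length_append]

variable (P)

theorem pad_length (n : ℕ) (l : List α) (h : l.length ≤ n) : (pad n l).length = n := by
  simp [pad, h]

theorem pad_reduceOption (n : ℕ) (l : List α) : (pad n l).reduceOption = l := by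
  have h : ∀ m, (List.replicate m (none : Option α)).reduceOption = [] := fun m => by
    induction m with
    | zero => rfl
    | succ m ih => simp [List.replicate_succ, ih]
  rw [pad, List.reduceOption_append, h, List.append_nil]
  simp [List.reduceOption, List.filterMap_map]

theorem distributeBucket_spec {τ : Fin P.D → Fin P.B} {x : Fin P.D → α} {s s' : DistState P α}
    (h : distributeBucket P τ x s = some s') (j : Fin P.B) :
    (s'.mid j).length = (s.mid j).length + P.C ∧
      (s'.mid j).reduceOption ++ s'.stash j =
        ((s.mid j).reduceOption ++ s.stash j) ++ itemsFor P τ x j P.D := by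
  obtain ⟨c, hc, rfl⟩ := Option.map_eq_some_iff.1 h
  have hp := foldlM_invariant _ _ (fun k c => ChunkState.Placed c s.stash τ x k)
    (fun k hk s s' hi hf => hi.step (by simpa using hk) (by simpa using hf))
    (unstash_placed s.stash τ x) hc
  rw [List.length_finRange] at hp
  refine ⟨?_, ?_⟩
  · rw [List.length_append, pad_length _ _ (hp.1 j).1]
  · simp only [List.reduceOption_append, pad_reduceOption, List.append_assoc]
    rw [hp.2]

/-- While items are placed the queues only grow, so their final lengths bound the lengths at every
step. A final total below `S` thus leaves room throughout. -/
theorem distributeBucket_isSome {τ : Fin P.D → Fin P.B} {x : Fin P.D → α} {s : DistState P α}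
    (h : ∑ j, ((s.stash j).length + targetCount P τ j - P.C) < P.S) :
    ∃ s', distributeBucket P τ x s = some s' ∧
      ∀ j, (s'.stash j).length = (s.stash j).length + targetCount P τ j - P.C := by
  obtain ⟨c, hc, hp⟩ := foldlM_succeeds
    (fun c i => placeItem P c (τ i) (x i)) (List.finRange P.D)
    (fun k c => ChunkState.Placed c s.stash τ x k)
    (fun k hk c hi => by
      have hk' : k < P.D := by simpa using hk
      obtain ⟨c', hc'⟩ := placeItem_isSome (c := c)
        (lt_of_le_of_lt (Finset.sum_le_sum fun j _ => by
          rw [hi.stash_length]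
          have := itemsFor_length_le P τ x j k
          omega) h) (τ ⟨k, hk'⟩) (x ⟨k, hk'⟩)
      exact ⟨c', by simpa using hc', hi.step hk' hc'⟩)
    (unstash_placed s.stash τ x)
  rw [List.length_finRange] at hp
  refine ⟨_, by rw [distributeBucket, hc]; rfl, fun j => ?_⟩
  simp only
  rw [hp.stash_length, itemsFor_length]

/-- The items with target `j` in the first `k` input buckets, in order. -/
def arrivals (T : Fin P.B → Fin P.D → Fin P.B) (input : Fin P.N → α) (j : Fin P.B) (k : ℕ) :
    List α :=
  ((List.finRange P.B).take k).flatMap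
    fun b => itemsFor P (T b) (fun i => input (P.dataIdx b i)) j P.D

theorem arrivals_succ (T : Fin P.B → Fin P.D → Fin P.B) (input : Fin P.N → α) (j : Fin P.B)
    {k : ℕ} (hk : k < P.B) :
    arrivals P T input j (k + 1) = arrivals P T input j k ++
      itemsFor P (T ⟨k, hk⟩) (fun i => input (P.dataIdx ⟨k, hk⟩ i)) j P.D := by
  have h : (List.finRange P.B).take (k + 1) = (List.finRange P.B).take k ++ [⟨k, hk⟩] := by
    rw [← List.take_concat_get' _ k (by simpa using hk)]; simp
  rw [arrivals, h, List.flatMap_append, List.flatMap_singleton, ← arrivals]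

/-- The length of the `j`-th stash queue after `b` input buckets if the stash is unbounded. -/
def queueLen (T : Fin P.B → Fin P.D → Fin P.B) (j : Fin P.B) : ℕ → ℕ
  | 0 => 0
  | b + 1 => if h : b < P.B then queueLen T j b + targetCount P (T ⟨b, h⟩) j - P.C else 0

/-- Stashing only delays items. On success each bucket holds all its arrivals in their order, in a
number of slots that does not depend on the targets. -/
theorem distribute_spec {T : Fin P.B → Fin P.D → Fin P.B} {input : Fin P.N → α}
    {mid : Fin P.B → List (Option α)} (h : distribute P T input = some mid) (j : Fin P.B) :
    (mid j).length = P.slots ∧ (mid j).reduceOption = arrivals P T input j P.B := by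
  obtain ⟨s, hs, hd⟩ := Option.bind_eq_some_iff.1 h
  have hp := foldlM_invariant _ _
    (fun k (s : DistState P α) => ∀ j, (s.mid j).length = P.C * k ∧
      (s.mid j).reduceOption ++ s.stash j = arrivals P T input j k)
    (fun k hk s s' hi hf j => by
      have hk' : k < P.B := by simpa using hk
      obtain ⟨h₁, h₂⟩ := distributeBucket_spec P hf j
      rw [h₁, h₂, (hi j).1, (hi j).2, arrivals_succ P T input j hk']
      simp [mul_add])
    (fun j => by simp [arrivals]) hs
  rw [List.length_finRange] at hp
  simp only [drainStash] at hd
  split_ifs at hd with hnil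
  obtain rfl := Option.some.inj hd
  have happ := unstash_append P P.K s.stash j
  rw [hnil j, List.append_nil] at happ
  refine ⟨?_, ?_⟩
  · rw [List.length_append, (hp j).1, pad_length]
    simp [unstash]
  · rw [List.reduceOption_append, pad_reduceOption, happ, (hp j).2]

theorem distribute_isSome (T : Fin P.B → Fin P.D → Fin P.B) (input : Fin P.N → α) (hB : 0 < P.B)
    (hK : (P.S : ℝ) / P.B ≤ P.K)
    (h : ∀ j : Fin P.B, ∀ b : Fin P.B, (queueLen P T j (b + 1) : ℝ) < P.S / P.B) :
    ∃ mid, distribute P T input = some mid := by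
  have hB' : (0 : ℝ) < P.B := by exact_mod_cast hB
  obtain ⟨s, hs, hp⟩ := foldlM_succeeds
    (fun s b => distributeBucket P (T b) (fun i => input (P.dataIdx b i)) s) (List.finRange P.B)
    (fun k (s : DistState P α) => ∀ j, (s.stash j).length = queueLen P T j k)
    (fun k hk s hi => by
      have hk' : k < P.B := by simpa using hk
      have hq : ∀ j, queueLen P T j (k + 1) =
          (s.stash j).length + targetCount P (T ⟨k, hk'⟩) j - P.C := fun j => by
        rw [queueLen, dif_pos hk', hi j]
      have hlt : ∑ j, ((s.stash j).length + targetCount P (T ⟨k, hk'⟩) j - P.C) < P.S := by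
        -- Bounding each queue by its share `S / B` bounds the total by `S`.
        have : ∑ j, (queueLen P T j (k + 1) : ℝ) < ∑ _j : Fin P.B, (P.S : ℝ) / P.B :=
          Finset.sum_lt_sum_of_nonempty ⟨⟨0, hB⟩, Finset.mem_univ _⟩
            fun j _ => h j ⟨k, hk'⟩
        rw [Finset.sum_const, Finset.card_univ, Fintype.card_fin, nsmul_eq_mul,
          mul_div_cancel₀ _ hB'.ne'] at this
        simp_rw [← hq]
        exact_mod_cast this
      obtain ⟨s', hs', hl⟩ := distributeBucket_isSome P
        (x := fun i => input (P.dataIdx ⟨k, hk'⟩ i)) hlt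
      exact ⟨s', by simpa using hs', fun j => by rw [hl, hq]⟩)
    (s₀ := { mid := fun _ => [], stash := fun _ => [] }) (fun j => by simp [queueLen])
  rw [List.length_finRange] at hp
  rw [distribute, hs, Option.bind_some, drainStash]
  refine ⟨_, if_pos fun j => ?_⟩
  simp only [unstash, List.drop_eq_nil_iff]
  -- The hypothesis at the last input bucket speaks of the queue after all `B` buckets, which `K`
  -- slots can hold.
  have hj := (h j ⟨P.B - 1, by omega⟩).le.trans hK
  simp only [Nat.sub_add_cancel hB] at hj
  rw [hp j]
  exact_mod_cast hj

end Distribution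

/-! ### The compression phase: a queue that preserves order -/

section Compression

variable {α : Type*} (P : Params)

/-- The items of the first `k` intermediate buckets. -/
def firstBuckets {n : ℕ} (bucket : Fin n → List α) (k : ℕ) : List α :=
  ((List.finRange n).take k).flatMap bucket

theorem firstBuckets_zero {n : ℕ} (bucket : Fin n → List α) : firstBuckets bucket 0 = [] := by
  simp [firstBuckets]

theorem firstBuckets_succ {n : ℕ} (bucket : Fin n → List α) {k : ℕ} (hk : k < n) :
    firstBuckets bucket (k + 1) = firstBuckets bucket k ++ bucket ⟨k, hk⟩ := by
  have h : (List.finRange n).take (k + 1) = (List.finRange n).take k ++ [⟨k, hk⟩] := by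
    rw [← List.take_concat_get' _ k (by simpa using hk)]; simp
  rw [firstBuckets, h, List.flatMap_append, List.flatMap_singleton, ← firstBuckets]

theorem firstBuckets_self {n : ℕ} (bucket : Fin n → List α) :
    firstBuckets bucket n = (List.ofFn bucket).flatten := by
  rw [firstBuckets, List.take_of_length_le (by simp), List.ofFn_eq_map, List.flatMap_def]

theorem drainQueue_spec {s s' : CompState α} (h : drainQueue P s = some s') :
    s'.out ++ s'.queue = s.out ++ s.queue ∧ s'.out.length = s.out.length + P.D := by
  unfold drainQueue at h
  split_ifs at h with hD
  obtain rfl := Option.some.inj h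
  simp only [List.append_assoc, List.take_append_drop, List.length_append, List.length_take,
    true_and]
  omega

theorem drainQueue_isSome {s : CompState α} (h : P.D ≤ s.queue.length) :
    ∃ s', drainQueue P s = some s' := by
  rw [drainQueue, if_neg (by omega)]
  exact ⟨_, rfl⟩

theorem checkQueue_eq_some {s s' : CompState α} (h : checkQueue P s = some s') : s' = s := by
  unfold checkQueue at h
  split_ifs at h
  exact (Option.some.inj h).symm

/-- The state of the compression phase after `r` reads and `w` writes. -/
def CompState.After (s : CompState α) (bucket : Fin P.B → List α) (r w : ℕ) : Prop :=
  s.out ++ s.queue = firstBuckets bucket r ∧ s.out.length = P.D * w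

variable {P}

theorem CompState.After.read {s : CompState α} {bucket : Fin P.B → List α} {r w : ℕ}
    (h : s.After P bucket r w) (hr : r < P.B) :
    (importBucket (bucket ⟨r, hr⟩) s).After P bucket (r + 1) w := by
  refine ⟨?_, h.2⟩
  rw [firstBuckets_succ bucket hr, ← h.1, importBucket, List.append_assoc]

theorem CompState.After.write {s s' : CompState α} {bucket : Fin P.B → List α} {r w : ℕ}
    (h : s.After P bucket r w) (hs : drainQueue P s = some s') :
    s'.After P bucket r (w + 1) := by
  obtain ⟨h₁, h₂⟩ := drainQueue_spec P hs
  exact ⟨h₁.trans h.1, by rw [h₂, h.2, mul_add, mul_one]⟩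

theorem CompState.After.length {s : CompState α} {bucket : Fin P.B → List α} {r w : ℕ}
    (h : s.After P bucket r w) :
    P.D * w + s.queue.length = (firstBuckets bucket r).length := by
  rw [← h.1, List.length_append, h.2]

variable (P)

theorem compress_eq (hW : P.W ≤ P.B) (bucket : Fin P.B → List α) :
    compress P bucket =
      (((List.finRange P.B).take P.W).foldlM
        (fun s b => checkQueue P (importBucket (bucket b) s)) ⟨[], []⟩).bind fun s₁ =>
      (((List.finRange P.B).drop P.W).foldlM
        (fun s b => (drainQueue P (importBucket (bucket b) s)).bind (checkQueue P)) s₁).bind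
          fun s₂ =>
      (((List.finRange P.B).drop (P.B - P.W)).foldlM (fun s _ => drainQueue P s) s₂).map
        fun s => s.out := by
  simp only [compress, min_eq_left hW, Option.map_eq_bind]
  rfl

/-- Output followed by queue is always the concatenation of the buckets read. At the end `B * D = N`
items are written, so the queue is empty. -/
theorem compress_spec (hW : P.W ≤ P.B) (bucket : Fin P.B → List α) {l : List α}
    (hN : (List.ofFn bucket).flatten.length = P.N) (h : compress P bucket = some l) :
    l = (List.ofFn bucket).flatten := by
  rw [compress_eq P hW] at h
  obtain ⟨s₁, h₁, h⟩ := Option.bind_eq_some_iff.1 h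
  obtain ⟨s₂, h₂, h⟩ := Option.bind_eq_some_iff.1 h
  obtain ⟨s₃, h₃, rfl⟩ := Option.map_eq_some_iff.1 h
  have i₁ := foldlM_invariant _ _ (fun k s => CompState.After P s bucket k 0)
    (fun k hk s s' hi hf => by
      have hk' : k < P.B := by simp at hk; omega
      have := checkQueue_eq_some P hf
      rw [this]
      simpa using hi.read hk')
    (by simp [CompState.After, firstBuckets_zero]) h₁
  rw [List.length_take, List.length_finRange, min_eq_left hW] at i₁
  have i₂ := foldlM_invariant _ _ (fun k s => CompState.After P s bucket (P.W + k) k)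
    (fun k hk s s' hi hf => by
      have hk' : P.W + k < P.B := by simp at hk; omega
      obtain ⟨u, hu, hc⟩ := Option.bind_eq_some_iff.1 hf
      rw [checkQueue_eq_some P hc]
      exact (hi.read hk').write (by simpa using hu))
    i₁ h₂
  rw [List.length_drop, List.length_finRange, Nat.add_sub_cancel' hW] at i₂
  have i₃ := foldlM_invariant _ _
    (fun k s => CompState.After P s bucket P.B (P.B - P.W + k))
    (fun k hk s s' hi hf => hi.write hf)
    i₂ h₃
  rw [List.length_drop, List.length_finRange, Nat.sub_sub_self hW, Nat.sub_add_cancel hW] at i₃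
  have hl := i₃.length
  have hq : s₃.queue = [] := by
    rw [← List.length_eq_zero_iff]
    rw [firstBuckets_self, hN, Params.N, mul_comm P.B] at hl
    omega
  have := i₃.1
  rwa [hq, List.append_nil, firstBuckets_self] at this

/-- With `Y i` items in the first `i` buckets, the lower bound on `Y (W + k + 1)` leaves at least
`D` items for write number `k + 1`, and the upper bound leaves at most `W * D + Q` after it. In the
first `W` reads only the upper bound matters; in the last writes all `N` items have been read, so
nothing can run short. -/
theorem compress_isSome (hW : P.W ≤ P.B) (bucket : Fin P.B → List α)
    (hN : (List.ofFn bucket).flatten.length = P.N)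
    (hlow : ∀ b : Fin P.B, P.D * (b + 1) ≤ (firstBuckets bucket (b + 1)).length + P.D * P.W)
    (hup : ∀ b : Fin P.B, (firstBuckets bucket (b + 1)).length ≤ P.D * (b + 1) + P.Q) :
    ∃ l, compress P bucket = some l := by
  rw [compress_eq P hW]
  obtain ⟨s₁, h₁, i₁⟩ := foldlM_succeeds
    (fun s b => checkQueue P (importBucket (bucket b) s)) ((List.finRange P.B).take P.W)
    (fun k s => CompState.After P s bucket k 0)
    (fun k hk s hi => by
      have hk₁ : k < P.W := by simp at hk; omega
      have hk' : k < P.B := by omega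
      have hr := hi.read hk'
      refine ⟨importBucket (bucket ⟨k, hk'⟩) s, ?_, hr⟩
      simp only [List.getElem_take, List.getElem_finRange, Fin.cast_mk]
      refine if_pos ?_
      have hl := hr.length
      have hu := hup ⟨k, hk'⟩
      have : P.D * (k + 1) ≤ P.W * P.D := by rw [mul_comm]; exact Nat.mul_le_mul_right _ hk₁
      simp only at hu
      omega)
    (s₀ := ⟨[], []⟩) (by simp [CompState.After, firstBuckets_zero])
  rw [List.length_take, List.length_finRange, min_eq_left hW] at i₁
  obtain ⟨s₂, h₂, i₂⟩ := foldlM_succeeds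
    (fun s b => (drainQueue P (importBucket (bucket b) s)).bind (checkQueue P))
    ((List.finRange P.B).drop P.W)
    (fun k s => CompState.After P s bucket (P.W + k) k)
    (fun k hk s hi => by
      have hk' : P.W + k < P.B := by simp at hk; omega
      have hr := hi.read hk'
      have hl := hr.length
      have hu := hup ⟨P.W + k, hk'⟩
      have hd := hlow ⟨P.W + k, hk'⟩
      simp only [mul_add, mul_one] at hu hd
      obtain ⟨u, hu'⟩ := drainQueue_isSome P (s := importBucket (bucket ⟨P.W + k, hk'⟩) s)
        (by omega)
      have hw := hr.write hu'
      have hl' := hw.length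
      refine ⟨u, ?_, hw⟩
      simp only [List.getElem_drop, List.getElem_finRange, Fin.cast_mk]
      rw [hu', Option.bind_some]
      refine if_pos ?_
      rw [mul_comm P.W]
      simp only [mul_add, mul_one] at hl'
      omega)
    (s₀ := s₁) i₁
  rw [List.length_drop, List.length_finRange, Nat.add_sub_cancel' hW] at i₂
  obtain ⟨s₃, h₃, -⟩ := foldlM_succeeds
    (fun s _ => drainQueue P s) ((List.finRange P.B).drop (P.B - P.W))
    (fun k s => CompState.After P s bucket P.B (P.B - P.W + k))
    (fun k hk s hi => by
      have hk' : k < P.W := by simp at hk; omega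
      have hl := hi.length
      rw [firstBuckets_self, hN, Params.N, mul_comm P.B] at hl
      have : P.D * (P.B - P.W + k) + P.D ≤ P.D * P.B := by
        rw [← Nat.mul_succ]; exact Nat.mul_le_mul_left _ (by omega)
      obtain ⟨u, hu⟩ := drainQueue_isSome P (s := s) (by omega)
      exact ⟨u, hu, hi.write hu⟩)
    (s₀ := s₂) i₂
  rw [h₁, Option.bind_some, h₂, Option.bind_some, h₃]
  exact ⟨_, rfl⟩

end Compression

/-! ### Counting slot permutations, and bucket sizes as counts of targets -/

section Shuffle

variable {α : Type*} (P : Params)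

/-- Permutations `ρ` of the points satisfying `p` act on all permutations by composition, changing
the filtered list from `L` to its image under `ρ`. As `L` contains every such point, the image
reveals `ρ`, and cancelling it reveals `σ`: the products are pairwise distinct. -/
theorem card_perm_filter_eq_mul_le {m : ℕ} (p : Fin m → Bool) (L : List (Fin m)) :
    (Finset.univ.filter fun σ : Equiv.Perm (Fin m) => (List.ofFn σ).filter p = L).card *
      (Fintype.card {i // p i = true}).factorial ≤ m.factorial := by
  rw [← Fintype.card_perm (α := {i // p i = true})]
  conv_rhs => rw [← Fintype.card_fin m, ← Fintype.card_perm (α := Fin m)]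
  rw [← Finset.card_univ (α := Equiv.Perm {i // p i = true}), ← Finset.card_product,
    ← Finset.card_univ]
  refine Finset.card_le_card_of_injOn
    (fun x => Equiv.Perm.ofSubtype x.2 * x.1) (fun _ _ => Finset.mem_coe.2 (Finset.mem_univ _)) ?_
  have key : ∀ (σ : Equiv.Perm (Fin m)) (ρ : Equiv.Perm {i // p i = true}),
      (List.ofFn σ).filter p = L →
        (List.ofFn (Equiv.Perm.ofSubtype ρ * σ)).filter p = L.map (Equiv.Perm.ofSubtype ρ) := by
    intro σ ρ h
    have : List.ofFn (Equiv.Perm.ofSubtype ρ * σ) =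
        (List.ofFn σ).map (Equiv.Perm.ofSubtype ρ) := by
      rw [List.map_ofFn]; rfl
    rw [this, List.filter_map, ← h]
    congr 2
    funext i
    simp only [Function.comp_apply]
    by_cases hi : p i = true
    · rw [Equiv.Perm.ofSubtype_apply_of_mem ρ hi, hi]
      exact (ρ ⟨i, hi⟩).2
    · rw [Equiv.Perm.ofSubtype_apply_of_not_mem ρ hi]
  rintro ⟨σ, ρ⟩ h₁ ⟨σ', ρ'⟩ h₂ h
  simp only [Finset.coe_product, Set.mem_prod, Finset.mem_coe, Finset.mem_filter, Finset.mem_univ,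
    true_and, and_true] at h₁ h₂ h
  have hL := key σ ρ h₁
  rw [h, key σ' ρ' h₂] at hL
  have hρ : ρ = ρ' := by
    ext ⟨i, hi⟩
    have hiL : i ∈ L := by
      rw [← h₁, List.mem_filter]
      exact ⟨List.mem_ofFn.2 ⟨σ.symm i, by simp⟩, hi⟩
    have := (List.map_inj_left.1 hL) i hiL
    rw [Equiv.Perm.ofSubtype_apply_of_mem ρ hi, Equiv.Perm.ofSubtype_apply_of_mem ρ' hi] at this
    rw [this]
  subst hρ
  rw [mul_left_cancel h]

/-- The map `g` is a partial inverse of `f`: distinct items let the order of the occupied slots be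
recovered from the order of the items. -/
theorem filter_isSome_eq_filterMap {β : Type*} (f : β → Option α)
    (hf : ∀ i i' x, f i = some x → f i' = some x → i = i') :
    ∃ g : α → Option β, ∀ l : List β,
      l.filter (fun i => (f i).isSome) = (l.filterMap f).filterMap g := by
  classical
  refine ⟨fun x => if h : ∃ i, f i = some x then some h.choose else none, fun l => ?_⟩
  rw [List.filterMap_filterMap, ← List.filterMap_eq_filter]
  congr 1
  funext i
  rcases hi : f i with - | x
  · simp [Option.guard, hi]
  · have hx : ∃ i, f i = some x := ⟨i, hi⟩
    simp only [Option.guard, hi, Option.isSome_some, if_true, Option.bind_some, dif_pos hx]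
    rw [hf _ _ _ hi hx.choose_spec]

theorem shuffleBucket_eq_filterMap (σ : Equiv.Perm (Fin P.slots)) (b : List (Option α)) :
    shuffleBucket P σ b = (List.ofFn σ).filterMap fun i : Fin _ => b.getD i none := by
  rw [shuffleBucket, List.reduceOption, List.ofFn_comp' σ fun i : Fin _ => b.getD i none,
    List.filterMap_map]
  rfl

theorem reduceOption_eq_filterMap {m : ℕ} (b : List (Option α)) (hb : b.length = m) :
    b.reduceOption = (List.finRange m).filterMap fun i : Fin _ => b.getD i none := by
  subst hb
  have : b = (List.finRange b.length).map fun i : Fin b.length => b.getD i none := by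
    rw [← List.ofFn_eq_map]
    refine List.ext_getElem (by simp) fun i h₁ h₂ => by simp
  conv_lhs => rw [this, List.reduceOption]
  rw [List.filterMap_map]
  rfl

theorem shuffleBucket_perm (σ : Equiv.Perm (Fin P.slots)) (b : List (Option α))
    (hb : b.length = P.slots) : (shuffleBucket P σ b).Perm b.reduceOption := by
  rw [shuffleBucket_eq_filterMap, reduceOption_eq_filterMap b hb]
  refine List.Perm.filterMap _ ?_
  have := Equiv.Perm.ofFn_comp_perm σ (id : Fin P.slots → Fin P.slots)
  rw [Function.id_comp] at this
  rwa [List.ofFn_id] at this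

/-- The resulting list fixes the order in which the occupied slots appear, so the count for filtered
permutations applies. -/
theorem card_shuffleBucket_mul_le (b : List (Option α)) (hb : b.length = P.slots)
    (hn : b.reduceOption.Nodup) (l : List α) [DecidableEq α] :
    (Finset.univ.filter fun σ : Equiv.Perm (Fin P.slots) => shuffleBucket P σ b = l).card *
      b.reduceOption.length.factorial ≤ P.slots.factorial := by
  set f : Fin P.slots → Option α := fun i => b.getD i none with hf
  have hr := reduceOption_eq_filterMap b hb
  have hinj : ∀ i i' x, f i = some x → f i' = some x → i = i' := by
    intro i i' x hi hi'
    rw [hr] at hn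
    by_contra hne
    have : Std.Symm fun a a' : Fin P.slots => ∀ x, f a = some x → ∀ y, f a' = some y → x ≠ y :=
      ⟨fun a a' h x hx y hy => (h y hy x hx).symm⟩
    have hp : (List.finRange P.slots).Pairwise
        fun a a' => ∀ x, f a = some x → ∀ y, f a' = some y → x ≠ y :=
      List.pairwise_filterMap.1 hn
    exact hp.forall (List.mem_finRange i) (List.mem_finRange i') hne x hi x hi' rfl
  obtain ⟨g, hg⟩ := filter_isSome_eq_filterMap f hinj
  have hlen : b.reduceOption.length = Fintype.card {i // (f i).isSome = true} := by
    rw [hr, List.length_filterMap_eq_countP, Fintype.card_subtype, List.countP_eq_length_filter,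
      ← List.toFinset_card_of_nodup ((List.nodup_finRange _).filter _)]
    congr 1
    ext i; simp [hf]
  rw [hlen]
  refine le_trans (Nat.mul_le_mul_right _ (Finset.card_le_card fun σ hσ => ?_))
    (card_perm_filter_eq_mul_le (fun i => (f i).isSome) (l.filterMap g))
  rw [Finset.mem_filter] at hσ ⊢
  refine ⟨Finset.mem_univ _, ?_⟩
  rw [hg, ← hσ.2, shuffleBucket_eq_filterMap]

variable {P}

theorem mem_arrivals {T : Fin P.B → Fin P.D → Fin P.B} {input : Fin P.N → α} {j : Fin P.B}
    {x : α} : x ∈ arrivals P T input j P.B ↔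
      ∃ b i, T b i = j ∧ input (P.dataIdx b i) = x := by
  rw [arrivals, List.take_of_length_le (by simp), List.mem_flatMap]
  simp [itemsFor, List.take_of_length_le]

theorem arrivals_length (T : Fin P.B → Fin P.D → Fin P.B) (input : Fin P.N → α) (j : Fin P.B) :
    (arrivals P T input j P.B).length = ∑ b, targetCount P (T b) j := by
  rw [arrivals, List.take_of_length_le (by simp), List.length_flatMap, ← List.ofFn_eq_map,
    List.sum_ofFn]
  simp_rw [itemsFor_length]

theorem arrivals_nodup (T : Fin P.B → Fin P.D → Fin P.B) {input : Fin P.N → α}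
    (hi : Function.Injective input) (j : Fin P.B) : (arrivals P T input j P.B).Nodup := by
  have hd : ∀ {b b' : Fin P.B} {i i' : Fin P.D},
      input (P.dataIdx b i) = input (P.dataIdx b' i') → (b, i) = (b', i') :=
    fun h => finProdFinEquiv.injective (hi h)
  rw [arrivals, List.take_of_length_le (by simp), List.nodup_flatMap]
  refine ⟨fun b _ => ?_, ?_⟩
  · rw [itemsFor, List.take_of_length_le (by simp)]
    exact ((List.nodup_finRange _).filter _).map fun i i' h => (Prod.mk.inj (hd h)).2
  · refine (List.nodup_finRange _).imp fun {b b'} hne => ?_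
    rw [Function.onFun, List.disjoint_left]
    intro x hx hx'
    simp only [itemsFor, List.mem_map] at hx hx'
    obtain ⟨i, -, h⟩ := hx
    obtain ⟨i', -, h'⟩ := hx'
    exact hne (Prod.mk.inj (hd (h.trans h'.symm))).1

theorem sum_targetCount (τ : Fin P.D → Fin P.B) (A : Finset (Fin P.B)) :
    ∑ j ∈ A, targetCount P τ j = (Finset.univ.filter fun i => τ i ∈ A).card := by
  rw [Finset.card_eq_sum_card_fiberwise (f := τ) (t := A) (fun i hi => by simpa using hi)]
  refine Finset.sum_congr rfl fun j hj => ?_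
  rw [targetCount]
  congr 1
  ext i
  simp only [Finset.mem_filter, Finset.mem_univ, true_and]
  exact ⟨fun h => ⟨h ▸ hj, h⟩, fun h => h.2⟩

/-- The number of items with target in `A`. -/
def hits (T : Fin P.B → Fin P.D → Fin P.B) (A : Finset (Fin P.B)) : ℕ :=
  ∑ b, (Finset.univ.filter fun i => T b i ∈ A).card

theorem sum_arrivals_length (T : Fin P.B → Fin P.D → Fin P.B) (input : Fin P.N → α)
    (A : Finset (Fin P.B)) : ∑ j ∈ A, (arrivals P T input j P.B).length = hits T A := by
  simp_rw [arrivals_length, hits]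
  rw [Finset.sum_comm]
  simp_rw [sum_targetCount]

theorem hits_univ (T : Fin P.B → Fin P.D → Fin P.B) : hits T Finset.univ = P.N := by
  simp [hits]

theorem firstBuckets_length {n : ℕ} (bucket : Fin n → List α) (k : ℕ) (hk : k ≤ n) :
    (firstBuckets bucket k).length =
      ∑ j ∈ Finset.univ.filter (fun j : Fin n => (j : ℕ) < k), (bucket j).length := by
  induction k with
  | zero => simp [firstBuckets_zero]
  | succ k ih =>
    rw [firstBuckets_succ bucket hk, List.length_append, ih (by omega)]
    have : Finset.univ.filter (fun j : Fin n => (j : ℕ) < k + 1) =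
        insert ⟨k, hk⟩ (Finset.univ.filter (fun j : Fin n => (j : ℕ) < k)) := by
      ext j
      simp [Fin.ext_iff]
      omega
    rw [this, Finset.sum_insert (by simp), add_comm]

end Shuffle

/-! ### No array is more likely than under a uniform shuffle -/

section Uniformity

variable {α : Type*} {P : Params}

theorem run_eq_some {T : Fin P.B → Fin P.D → Fin P.B} {σ : Fin P.B → Equiv.Perm (Fin P.slots)}
    {input : Fin P.N → α} {l : List α} (hW : P.W ≤ P.B) (h : run P (T, σ) input = some l) :
    ∃ mid, distribute P T input = some mid ∧
      l = (List.ofFn fun j => shuffleBucket P (σ j) (mid j)).flatten := by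
  obtain ⟨mid, hm, hc⟩ := Option.bind_eq_some_iff.1 h
  refine ⟨mid, hm, compress_spec P hW _ ?_ hc⟩
  rw [List.length_flatten, List.map_ofFn, List.sum_ofFn, ← hits_univ T,
    ← sum_arrivals_length T input]
  refine Finset.sum_congr rfl fun j _ => ?_
  obtain ⟨h₁, h₂⟩ := distribute_spec P hm j
  rw [Function.comp_apply, (shuffleBucket_perm P (σ j) (mid j) h₁).length_eq, h₂]

theorem run_isSome {T : Fin P.B → Fin P.D → Fin P.B} (σ : Fin P.B → Equiv.Perm (Fin P.slots))
    (input : Fin P.N → α) (hB : 0 < P.B) (hK : (P.S : ℝ) / P.B ≤ P.K) (hW : P.W ≤ P.B)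
    (hq : ∀ j b : Fin P.B, (queueLen P T j (b + 1) : ℝ) < P.S / P.B)
    (hlow : ∀ b : Fin P.B, P.D * (b + 1) ≤
      hits T (Finset.univ.filter fun j => (j : ℕ) < b + 1) + P.D * P.W)
    (hup : ∀ b : Fin P.B,
      hits T (Finset.univ.filter fun j => (j : ℕ) < b + 1) ≤ P.D * (b + 1) + P.Q) :
    ∃ l, run P (T, σ) input = some l := by
  obtain ⟨mid, hm⟩ := distribute_isSome P T input hB hK hq
  have hlen : ∀ j, (shuffleBucket P (σ j) (mid j)).length = (arrivals P T input j P.B).length :=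
    fun j => by
      obtain ⟨h₁, h₂⟩ := distribute_spec P hm j
      rw [(shuffleBucket_perm P (σ j) (mid j) h₁).length_eq, h₂]
  have hfb : ∀ b : Fin P.B,
      (firstBuckets (fun j => shuffleBucket P (σ j) (mid j)) (b + 1)).length =
        hits T (Finset.univ.filter fun j => (j : ℕ) < b + 1) := fun b => by
    rw [firstBuckets_length _ _ b.2, ← sum_arrivals_length T input]
    exact Finset.sum_congr rfl fun j _ => hlen j
  obtain ⟨l, hl⟩ := compress_isSome P hW (fun j => shuffleBucket P (σ j) (mid j))
    (by
      rw [List.length_flatten, List.map_ofFn, List.sum_ofFn, ← hits_univ T,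
        ← sum_arrivals_length T input]
      exact Finset.sum_congr rfl fun j _ => hlen j)
    (fun b => by rw [hfb]; exact hlow b) (fun b => by rw [hfb]; exact hup b)
  exact ⟨l, by rw [run, hm]; exact hl⟩

/-- For fixed targets neither the intermediate buckets nor their sizes depend on `σ`. Equal outputs
therefore agree block by block, and the permutations can be counted bucket by bucket. -/
theorem card_run_eq_some_mul_le [DecidableEq α] (hW : P.W ≤ P.B) (T : Fin P.B → Fin P.D → Fin P.B)
    {input : Fin P.N → α} (hi : Function.Injective input) (l : List α) :
    (Finset.univ.filter fun σ => run P (T, σ) input = some l).card *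
      ∏ j, (arrivals P T input j P.B).length.factorial ≤ P.slots.factorial ^ P.B := by
  rcases Finset.eq_empty_or_nonempty
    (Finset.univ.filter fun σ => run P (T, σ) input = some l) with h | ⟨σ₀, h₀⟩
  · rw [h]; simp
  obtain ⟨mid, hm, hl⟩ := run_eq_some hW (Finset.mem_filter.1 h₀).2
  -- One successful choice `σ₀` serves as the reference that says what each block of `l` must be.
  have hsub : (Finset.univ.filter fun σ => run P (T, σ) input = some l) ⊆
      Fintype.piFinset fun j => Finset.univ.filter fun τ : Equiv.Perm (Fin P.slots) =>
        shuffleBucket P τ (mid j) = shuffleBucket P (σ₀ j) (mid j) := by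
    intro σ hσ
    obtain ⟨mid', hm', hl'⟩ := run_eq_some hW (Finset.mem_filter.1 hσ).2
    obtain rfl : mid = mid' := Option.some.inj (hm.symm.trans hm')
    have := List.eq_iff_flatten_eq.2 ⟨hl'.symm.trans hl, by
      rw [List.map_ofFn, List.map_ofFn]
      congr 1
      funext j
      have h₁ := (distribute_spec P hm j).1
      simp only [Function.comp_apply]
      rw [(shuffleBucket_perm P (σ j) (mid j) h₁).length_eq,
        (shuffleBucket_perm P (σ₀ j) (mid j) h₁).length_eq]⟩
    have := List.ofFn_injective this
    exact Fintype.mem_piFinset.2 fun j =>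
      Finset.mem_filter.2 ⟨Finset.mem_univ _, congrFun this j⟩
  refine le_trans (Nat.mul_le_mul_right _ (Finset.card_le_card hsub)) ?_
  rw [Fintype.card_piFinset, ← Finset.prod_mul_distrib]
  calc _ ≤ ∏ _j : Fin P.B, P.slots.factorial := Finset.prod_le_prod' fun j _ => by
        obtain ⟨h₁, h₂⟩ := distribute_spec P hm j
        rw [← h₂]
        exact card_shuffleBucket_mul_le P (mid j) h₁ (h₂ ▸ arrivals_nodup T hi j) _
    _ = _ := by simp

/-- Equal sizes cut `l` into the same blocks, and the target of an item is the index of its block.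
-/
theorem targets_eq_of_run (hW : P.W ≤ P.B) {T T' : Fin P.B → Fin P.D → Fin P.B}
    {σ σ' : Fin P.B → Equiv.Perm (Fin P.slots)} {input : Fin P.N → α}
    (hi : Function.Injective input) {l : List α} (h : run P (T, σ) input = some l)
    (h' : run P (T', σ') input = some l)
    (hlen : ∀ j, (arrivals P T input j P.B).length = (arrivals P T' input j P.B).length) :
    T = T' := by
  obtain ⟨mid, hm, hl⟩ := run_eq_some hW h
  obtain ⟨mid', hm', hl'⟩ := run_eq_some hW h'
  have hp : ∀ j, (shuffleBucket P (σ j) (mid j)).Perm (arrivals P T input j P.B) := fun j => by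
    obtain ⟨h₁, h₂⟩ := distribute_spec P hm j
    exact h₂ ▸ shuffleBucket_perm P _ _ h₁
  have hp' : ∀ j, (shuffleBucket P (σ' j) (mid' j)).Perm (arrivals P T' input j P.B) :=
    fun j => by
      obtain ⟨h₁, h₂⟩ := distribute_spec P hm' j
      exact h₂ ▸ shuffleBucket_perm P _ _ h₁
  have heq := List.ofFn_injective <| List.eq_iff_flatten_eq.2 ⟨hl.symm.trans hl', by
    rw [List.map_ofFn, List.map_ofFn]
    congr 1
    funext j
    simp only [Function.comp_apply]
    rw [(hp j).length_eq, (hp' j).length_eq, hlen]⟩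
  funext b i
  have hmem : input (P.dataIdx b i) ∈ arrivals P T input (T b i) P.B :=
    mem_arrivals.2 ⟨b, i, rfl, rfl⟩
  rw [← (hp _).mem_iff, congrFun heq (T b i), (hp' _).mem_iff, mem_arrivals] at hmem
  obtain ⟨b', i', hT, hx⟩ := hmem
  obtain ⟨rfl, rfl⟩ := Prod.mk.inj (finProdFinEquiv.injective (hi hx))
  exact hT.symm

theorem card_coins (P : Params) : Fintype.card (Coins P) =
    P.slots.factorial ^ P.B * P.B ^ P.N := by
  simp [Coins, Fintype.card_perm, ← pow_mul, mul_comm]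

theorem card_run_mul_factorial_le [DecidableEq α] (hW : P.W ≤ P.B) {input : Fin P.N → α}
    (hi : Function.Injective input) (l : List α) :
    (Finset.univ.filter fun ω : Coins P => run P ω input = some l).card * P.N.factorial ≤
      Fintype.card (Coins P) := by
  classical
  set F : (Fin P.B → Fin P.D → Fin P.B) → ℕ := fun T =>
    (Finset.univ.filter fun σ => run P (T, σ) input = some l).card with hF
  set n : (Fin P.B → Fin P.D → Fin P.B) → Fin P.B → ℕ :=
    fun T j => (arrivals P T input j P.B).length with hn
  have hsum : ∀ T, ∑ j, n T j = P.N := fun T => by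
    rw [← hits_univ T, ← sum_arrivals_length T input]
  have hcard : (Finset.univ.filter fun ω : Coins P => run P ω input = some l).card =
      ∑ T, F T := by
    simp only [hF, Finset.card_filter]
    exact Fintype.sum_prod_type _
  -- Sizes determine targets only among the targets that can produce `l`.
  set G := Finset.univ.filter fun T => F T ≠ 0 with hG
  have hinj : Set.InjOn n G := by
    intro T hT T' hT' h
    obtain ⟨σ, hσ⟩ := Finset.card_ne_zero.1 (Finset.mem_filter.1 (Finset.mem_coe.1 hT)).2
    obtain ⟨σ', hσ'⟩ := Finset.card_ne_zero.1 (Finset.mem_filter.1 (Finset.mem_coe.1 hT')).2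
    exact targets_eq_of_run hW hi (Finset.mem_filter.1 hσ).2 (Finset.mem_filter.1 hσ').2
      fun j => congrFun h j
  have hF' : ∀ T, F T * P.N.factorial ≤
      P.slots.factorial ^ P.B * Nat.multinomial Finset.univ (n T) := fun T => by
    rw [← hsum T, ← Nat.multinomial_spec, ← mul_assoc]
    exact Nat.mul_le_mul_right _ (card_run_eq_some_mul_le hW T hi l)
  rw [hcard, card_coins]
  calc (∑ T, F T) * P.N.factorial = ∑ T ∈ G, F T * P.N.factorial := by
        rw [hG, Finset.sum_mul, Finset.sum_filter_of_ne]
        intro T _ h h0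
        exact h (by rw [h0, zero_mul])
    _ ≤ ∑ T ∈ G, P.slots.factorial ^ P.B * Nat.multinomial Finset.univ (n T) :=
        Finset.sum_le_sum fun T _ => hF' T
    _ = P.slots.factorial ^ P.B * ∑ k ∈ G.image n, Nat.multinomial Finset.univ k := by
        rw [Finset.mul_sum, Finset.sum_image hinj]
    _ ≤ P.slots.factorial ^ P.B *
          ∑ k ∈ Finset.piAntidiag Finset.univ P.N, Nat.multinomial Finset.univ k := by
        refine Nat.mul_le_mul_left _ (Finset.sum_le_sum_of_subset fun k hk => ?_)
        obtain ⟨T, -, rfl⟩ := Finset.mem_image.1 hk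
        exact Finset.mem_piAntidiag.2 ⟨hsum T, fun _ _ => Finset.mem_univ _⟩
    _ = P.slots.factorial ^ P.B * P.B ^ P.N := by
        -- Multinomial theorem for `(1 + ⋯ + 1) ^ N` with `B` ones.
        have := Finset.sum_pow_eq_sum_piAntidiag (Finset.univ : Finset (Fin P.B))
          (fun _ => (1 : ℕ)) P.N
        simp only [one_pow, Finset.prod_const_one, mul_one, Finset.sum_const, Finset.card_univ,
          Fintype.card_fin, smul_eq_mul, Nat.cast_id] at this
        rw [this]

theorem nodup_of_run (hW : P.W ≤ P.B) {ω : Coins P} {input : Fin P.N → α}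
    (hi : Function.Injective input) {l : List α} (h : run P ω input = some l) :
    l.Nodup ∧ l.length = P.N := by
  obtain ⟨T, σ⟩ := ω
  obtain ⟨mid, hm, rfl⟩ := run_eq_some hW h
  have hp : ∀ j, (shuffleBucket P (σ j) (mid j)).Perm (arrivals P T input j P.B) := fun j => by
    obtain ⟨h₁, h₂⟩ := distribute_spec P hm j
    exact h₂ ▸ shuffleBucket_perm P _ _ h₁
  refine ⟨List.nodup_flatten.2 ⟨fun L hL => ?_, ?_⟩, ?_⟩
  · obtain ⟨j, rfl⟩ := List.mem_ofFn.1 hL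
    exact (hp j).nodup_iff.2 (arrivals_nodup T hi j)
  · rw [List.pairwise_ofFn]
    intro j j' hlt
    rw [List.disjoint_left]
    intro x hx hx'
    rw [(hp _).mem_iff, mem_arrivals] at hx hx'
    obtain ⟨b, i, hT, hx⟩ := hx
    obtain ⟨b', i', hT', hx'⟩ := hx'
    obtain ⟨rfl, rfl⟩ := Prod.mk.inj (finProdFinEquiv.injective (hi (hx.trans hx'.symm)))
    exact hlt.ne (hT.symm.trans hT')
  · rw [List.length_flatten, List.map_ofFn, List.sum_ofFn, ← hits_univ T,
      ← sum_arrivals_length T input]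
    exact Finset.sum_congr rfl fun j _ => (hp j).length_eq

end Uniformity

/-! ### From pointwise domination to statistical distance -/

section Distance

theorem map_uniformOfFintype_apply {Ω β : Type*} [Fintype Ω] [Nonempty Ω] [DecidableEq β]
    (f : Ω → β) (b : β) : (PMF.uniformOfFintype Ω).map f b =
      ((Finset.univ.filter fun ω => f ω = b).card : ENNReal) / Fintype.card Ω := by
  rw [PMF.map_apply, tsum_fintype, Finset.card_filter, Nat.cast_sum, div_eq_mul_inv,
    Finset.sum_mul]
  refine Finset.sum_congr rfl fun ω _ => ?_
  by_cases h : b = f ω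
  · simp [h]
  · simp [h, Ne.symm h]

theorem toOuterMeasure_add_compl {β : Type*} (p : PMF β) (A : Set β) :
    p.toOuterMeasure A + p.toOuterMeasure Aᶜ = 1 := by
  rw [PMF.toOuterMeasure_apply, PMF.toOuterMeasure_apply, ← ENNReal.tsum_add, ← p.tsum_coe]
  exact tsum_congr fun x => Set.indicator_self_add_compl_apply A p x

/-- Domination off `b` gives `p A ≤ q A + p b` for every event; applied to the complement, it gives
the other sign. -/
theorem statDist_le_of_le_of_ne {β : Type*} (p q : PMF β) (b : β) (h : ∀ a, a ≠ b → p a ≤ q a) :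
    statDist p q ≤ (p b).toReal := by
  classical
  have hle : ∀ (r : PMF β) (A : Set β), r.toOuterMeasure A ≠ ⊤ := fun r A =>
    ne_top_of_le_ne_top ENNReal.one_ne_top ((toOuterMeasure_add_compl r A) ▸ le_self_add)
  have hA : ∀ A : Set β,
      (p.toOuterMeasure A).toReal ≤ (q.toOuterMeasure A).toReal + (p b).toReal := by
    intro A
    rw [← ENNReal.toReal_add (hle q A) (p.apply_ne_top b)]
    refine ENNReal.toReal_mono (ENNReal.add_ne_top.2 ⟨hle q A, p.apply_ne_top b⟩) ?_
    rw [PMF.toOuterMeasure_apply, PMF.toOuterMeasure_apply,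
      ← tsum_ite_eq b (fun _ => p b), ← ENNReal.tsum_add]
    refine ENNReal.tsum_le_tsum fun a => ?_
    by_cases ha : a = b
    · subst ha
      simp only [if_true]
      exact le_add_left (Set.indicator_le_self' (fun _ _ => zero_le) a)
    · exact le_add_right (Set.indicator_le_indicator (h a ha))
  have hc : ∀ (r : PMF β) (A : Set β),
      (r.toOuterMeasure A).toReal = 1 - (r.toOuterMeasure Aᶜ).toReal := fun r A => by
    rw [eq_sub_iff_add_eq, ← ENNReal.toReal_add (hle r A) (hle r Aᶜ),
      toOuterMeasure_add_compl, ENNReal.toReal_one]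
  refine ciSup_le fun A => abs_le.2 ⟨?_, ?_⟩
  · have := hA Aᶜ
    rw [hc p A, hc q A]
    linarith
  · linarith [hA A]

theorem statDist_le_failure (P : Params) (hW : P.W ≤ P.B) (input : Equiv.Perm (Fin P.N)) :
    statDist (outputDist P input) (uniformDist P.N) ≤
      ((Finset.univ.filter fun ω : Coins P => run P ω input = none).card : ℝ) /
        Fintype.card (Coins P) := by
  have hnone : (outputDist P input none).toReal =
      ((Finset.univ.filter fun ω : Coins P => run P ω input = none).card : ℝ) /
        Fintype.card (Coins P) := by
    rw [outputDist, map_uniformOfFintype_apply, ENNReal.toReal_div, ENNReal.toReal_natCast,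
      ENNReal.toReal_natCast]
  rw [← hnone]
  refine statDist_le_of_le_of_ne _ _ none fun a ha => ?_
  obtain ⟨l, rfl⟩ := Option.ne_none_iff_exists'.1 ha
  rw [outputDist, map_uniformOfFintype_apply]
  -- An unreachable list has mass zero. A reachable one is an arrangement of the items, hence has
  -- uniform mass at least `1 / N!`.
  rcases Finset.eq_empty_or_nonempty
    (Finset.univ.filter fun ω : Coins P => run P ω input = some l) with h | ⟨ω, hω⟩
  · rw [h]; simp
  obtain ⟨hnd, hlen⟩ := nodup_of_run hW input.injective (Finset.mem_filter.1 hω).2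
  have hinj : Function.Injective fun i : Fin P.N => l.get (i.cast hlen.symm) := fun i j h => by
    simpa using hnd.injective_get h
  set π := Equiv.ofBijective _ (Finite.injective_iff_bijective.1 hinj) with hπ
  have hl : List.ofFn (fun i => π i) = l := by
    refine List.ext_get (by simp [hlen]) fun i h₁ h₂ => ?_
    simp [hπ]
  rw [uniformDist, map_uniformOfFintype_apply]
  have hone : (1 : ENNReal) / P.N.factorial ≤
      ((Finset.univ.filter fun π : Equiv.Perm (Fin P.N) =>
        some (List.ofFn fun i => π i) = some l).card : ENNReal) /
          Fintype.card (Equiv.Perm (Fin P.N)) := by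
    rw [Fintype.card_perm, Fintype.card_fin]
    refine ENNReal.div_le_div_right ?_ _
    exact_mod_cast Finset.card_pos.2 ⟨π, Finset.mem_filter.2 ⟨Finset.mem_univ _, by rw [hl]⟩⟩
  refine le_trans ?_ hone
  rw [ENNReal.le_div_iff_mul_le (Or.inl (by exact_mod_cast P.N.factorial_ne_zero))
    (Or.inl (ENNReal.natCast_ne_top _)), mul_comm, ← mul_div_assoc]
  refine ENNReal.div_le_of_le_mul ?_
  rw [one_mul, mul_comm]
  exact_mod_cast card_run_mul_factorial_le hW input.injective l

end Distance

/-! ### Exponential moments and tail bounds -/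

section Tails

/-- Markov's inequality for `exp (s * X)`, in counting form. -/
theorem card_le_of_sum_exp_le {Ω : Type*} [Fintype Ω] (X : Ω → ℝ) (a s M : ℝ) (hs : 0 ≤ s)
    (h : ∑ ω, Real.exp (s * X ω) ≤ M) :
    ((Finset.univ.filter fun ω => a ≤ X ω).card : ℝ) ≤ M * Real.exp (-(s * a)) := by
  rw [Real.exp_neg, ← div_eq_mul_inv, le_div_iff₀ (Real.exp_pos _), ← nsmul_eq_mul,
    ← Finset.sum_const]
  refine le_trans (Finset.sum_le_sum fun ω hω => ?_) (le_trans
    (Finset.sum_le_sum_of_subset_of_nonneg (Finset.subset_univ _)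
      fun ω _ _ => (Real.exp_pos _).le) h)
  exact Real.exp_le_exp.2 (mul_le_mul_of_nonneg_left (Finset.mem_filter.1 hω).2 hs)

/-- Independence of coordinates, in counting form. -/
theorem sum_prod_pi {ι κ : Type*} [Fintype ι] [DecidableEq ι] [Fintype κ] (g : ι → κ → ℝ) :
    ∑ f : ι → κ, ∏ i, g i (f i) = ∏ i, ∑ k, g i k := by
  rw [Finset.prod_univ_sum, Fintype.piFinset_univ]

/-- Hoeffding's lemma for a uniform choice of a point. -/
theorem sum_exp_indicator_le {n : ℕ} (hn : 0 < n) (A : Finset (Fin n)) (s : ℝ) :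
    ∑ k, Real.exp (s * ((if k ∈ A then 1 else 0) - (A.card : ℝ) / n)) ≤
      n * Real.exp (s ^ 2 / 8) := by
  have : Nonempty (Fin n) := ⟨⟨0, hn⟩⟩
  have hn' : (0 : ℝ) < n := by exact_mod_cast hn
  set X : Fin n → ℝ := fun k => if k ∈ A then 1 else 0 with hX
  set μ := (PMF.uniformOfFintype (Fin n)).toMeasure with hμ
  have hint : ∀ f : Fin n → ℝ, ∫ k, f k ∂μ = (∑ k, f k) / n := fun f => by
    rw [hμ, PMF.integral_eq_sum, Finset.sum_div]
    refine Finset.sum_congr rfl fun k _ => ?_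
    simp [div_eq_inv_mul]
  have h := ProbabilityTheory.hasSubgaussianMGF_of_mem_Icc (μ := μ) (X := X) (a := 0) (b := 1)
    (measurable_of_finite X).aemeasurable
    (Filter.Eventually.of_forall fun k => by
      simp only [hX]; split_ifs <;> simp)
  have hm := h.mgf_le s
  have hEX : ∫ k, X k ∂μ = (A.card : ℝ) / n := by
    rw [hint]; simp [hX]
  rw [ProbabilityTheory.mgf, hint, hEX, div_le_iff₀ hn', mul_comm] at hm
  refine hm.trans_eq ?_
  congr 2
  simp
  ring

variable {P : Params}

theorem hits_eq_sum (T : Fin P.B → Fin P.D → Fin P.B) (A : Finset (Fin P.B)) :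
    (hits T A : ℝ) = ∑ b, ∑ i, if T b i ∈ A then (1 : ℝ) else 0 := by
  rw [hits, Nat.cast_sum]
  refine Finset.sum_congr rfl fun b _ => ?_
  rw [Finset.card_filter]
  push_cast
  rfl

theorem sum_exp_hits_le (hB : 0 < P.B) (A : Finset (Fin P.B)) (s : ℝ) :
    ∑ T : Fin P.B → Fin P.D → Fin P.B,
        Real.exp (s * ((hits T A : ℝ) - P.D * A.card)) ≤
      (P.B : ℝ) ^ P.N * Real.exp (P.N * (s ^ 2 / 8)) := by
  have hB' : (0 : ℝ) < P.B := by exact_mod_cast hB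
  have hT : ∀ T : Fin P.B → Fin P.D → Fin P.B,
      Real.exp (s * ((hits T A : ℝ) - P.D * A.card)) =
        ∏ b, ∏ i, Real.exp (s * ((if T b i ∈ A then 1 else 0) - (A.card : ℝ) / P.B)) := by
    intro T
    simp_rw [← Real.exp_sum, ← Finset.mul_sum, Finset.sum_sub_distrib]
    rw [hits_eq_sum]
    simp only [Finset.sum_const, Finset.card_univ, Fintype.card_fin, nsmul_eq_mul]
    congr 3
    field_simp
  simp_rw [hT]
  rw [sum_prod_pi (fun (_ : Fin P.B) (τ : Fin P.D → Fin P.B) =>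
    ∏ i, Real.exp (s * ((if τ i ∈ A then 1 else 0) - (A.card : ℝ) / P.B)))]
  simp_rw [sum_prod_pi (fun (_ : Fin P.D) (k : Fin P.B) =>
    Real.exp (s * ((if k ∈ A then 1 else 0) - (A.card : ℝ) / P.B)))]
  simp only [Finset.prod_const, Finset.card_univ, Fintype.card_fin]
  rw [← pow_mul, mul_comm P.D]
  refine (pow_le_pow_left₀ (Finset.sum_nonneg fun k _ => (Real.exp_pos _).le)
    (sum_exp_indicator_le hB A s) _).trans_eq ?_
  rw [mul_pow, ← Real.exp_nat_mul]

/-- Hoeffding's inequality for the number of items with target in `A`. -/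
theorem card_hits_ge_le (hB : 0 < P.B) (hD : 0 < P.D) (A : Finset (Fin P.B)) {r : ℝ}
    (hr : 0 ≤ r) :
    ((Finset.univ.filter fun T : Fin P.B → Fin P.D → Fin P.B =>
      r ≤ (hits T A : ℝ) - P.D * A.card).card : ℝ) ≤
      (P.B : ℝ) ^ P.N * Real.exp (-2 * r ^ 2 / P.N) := by
  have hN : (0 : ℝ) < P.N := by exact_mod_cast Nat.mul_pos hB hD
  -- The value `s = 4 r / N` minimises `N s² / 8 - s r`.
  have := card_le_of_sum_exp_le _ r (4 * r / P.N) _ (by positivity)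
    (sum_exp_hits_le hB A (4 * r / P.N))
  refine this.trans_eq ?_
  rw [mul_assoc, ← Real.exp_add]
  congr 2
  field_simp
  ring

/-- The exponential weight of the arrivals for the `j`-th output bucket from one input bucket. -/
noncomputable def weight (P : Params) (t : ℝ) (j : Fin P.B) (τ : Fin P.D → Fin P.B) : ℝ :=
  Real.exp (t * ((targetCount P τ j : ℝ) - P.C))

/-- The mean weight is `exp (-t C) (1 + (e^t - 1) / B)^D`, at most `exp (D (e^t - 1) / B - t C)` by
`1 + x ≤ e^x`. The condition on `e^t` puts this exponent below `-log 2`. -/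
theorem sum_weight_le (hB : 0 < P.B) (hD : 0 < P.D) {t : ℝ}
    (hexp : Real.exp t < 1 + (t * P.C - Real.log 2) * P.B / P.D) (j : Fin P.B) :
    ∑ τ, weight P t j τ ≤ (P.B : ℝ) ^ P.D * (1 / 2) := by
  have hB' : (0 : ℝ) < P.B := by exact_mod_cast hB
  have hD' : (0 : ℝ) < P.D := by exact_mod_cast hD
  have hτ : ∀ τ : Fin P.D → Fin P.B, weight P t j τ =
      Real.exp (-(t * P.C)) * ∏ i, if τ i = j then Real.exp t else 1 := by
    intro τ
    rw [Finset.prod_ite, Finset.prod_const, Finset.prod_const_one, mul_one, ← Real.exp_nat_mul,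
      ← Real.exp_add, weight, targetCount]
    congr 1
    ring
  simp_rw [hτ]
  rw [← Finset.mul_sum, sum_prod_pi (fun (_ : Fin P.D) (k : Fin P.B) =>
    if k = j then Real.exp t else 1), Finset.prod_const, Finset.card_univ, Fintype.card_fin]
  have hk : ∑ k : Fin P.B, (if k = j then Real.exp t else 1) ≤
      P.B * Real.exp ((Real.exp t - 1) / P.B) := by
    have : ∀ k : Fin P.B, (if k = j then Real.exp t else 1) =
        1 + if k = j then Real.exp t - 1 else 0 := fun k => by split_ifs <;> ring
    simp_rw [this, Finset.sum_add_distrib]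
    simp only [Finset.sum_const, Finset.card_univ, Fintype.card_fin, nsmul_eq_mul, mul_one,
      Finset.sum_ite_eq', Finset.mem_univ, if_true]
    have h := mul_le_mul_of_nonneg_left (Real.add_one_le_exp ((Real.exp t - 1) / P.B)) hB'.le
    refine le_trans (le_of_eq ?_) h
    field_simp
    ring
  have hpow := pow_le_pow_left₀
    (Finset.sum_nonneg fun k _ => by split_ifs <;> positivity) hk P.D
  refine (mul_le_mul_of_nonneg_left hpow (Real.exp_pos _).le).trans ?_
  rw [mul_pow, ← Real.exp_nat_mul, mul_left_comm, ← Real.exp_add]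
  refine mul_le_mul_of_nonneg_left ?_ (by positivity)
  have hhalf : (1 / 2 : ℝ) = Real.exp (-Real.log 2) := by
    rw [Real.exp_neg, Real.exp_log two_pos, one_div]
  rw [hhalf, Real.exp_le_exp]
  have h : (Real.exp t - 1) < (t * P.C - Real.log 2) * P.B / P.D := by linarith
  rw [lt_div_iff₀ hD'] at h
  have : (P.D : ℝ) * ((Real.exp t - 1) / P.B) ≤ t * P.C - Real.log 2 := by
    rw [← mul_div_assoc, div_le_iff₀ hB']
    linarith
  linarith

theorem sum_prod_weight_le (hB : 0 < P.B) (hD : 0 < P.D) {t : ℝ}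
    (hexp : Real.exp t < 1 + (t * P.C - Real.log 2) * P.B / P.D) (j : Fin P.B)
    (A : Finset (Fin P.B)) :
    ∑ T : Fin P.B → Fin P.D → Fin P.B, ∏ b ∈ A, weight P t j (T b) ≤
      (P.B : ℝ) ^ P.N * (1 / 2) ^ A.card := by
  have hT : ∀ T : Fin P.B → Fin P.D → Fin P.B, ∏ b ∈ A, weight P t j (T b) =
      ∏ b, if b ∈ A then weight P t j (T b) else 1 := fun T => by
    rw [Finset.prod_ite_mem, Finset.univ_inter]
  simp_rw [hT]
  rw [sum_prod_pi (fun (b : Fin P.B) τ => if b ∈ A then weight P t j τ else 1)]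
  have hb : ∀ b : Fin P.B, ∑ τ : Fin P.D → Fin P.B, (if b ∈ A then weight P t j τ else 1) ≤
      (P.B : ℝ) ^ P.D * if b ∈ A then 1 / 2 else 1 := fun b => by
    split_ifs
    · exact sum_weight_le hB hD hexp j
    · simp
  refine (Finset.prod_le_prod (fun b _ => Finset.sum_nonneg fun τ _ => ?_)
    fun b _ => hb b).trans_eq ?_
  · split_ifs
    · exact (Real.exp_pos _).le
    · exact zero_le_one
  · rw [Finset.prod_mul_distrib, Finset.prod_ite_mem, Finset.univ_inter]
    simp [← pow_mul, mul_comm]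

/-- The input buckets from `a` up to, and without, `b`. -/
def bucketsBetween (n a b : ℕ) : Finset (Fin n) :=
  Finset.univ.filter fun c => a ≤ (c : ℕ) ∧ (c : ℕ) < b

theorem bucketsBetween_self (n a : ℕ) : bucketsBetween n a a = ∅ := by
  ext c; simp [bucketsBetween]

theorem bucketsBetween_succ {n a b : ℕ} (hab : a ≤ b) (hb : b < n) :
    bucketsBetween n a (b + 1) = insert ⟨b, hb⟩ (bucketsBetween n a b) ∧
      ⟨b, hb⟩ ∉ bucketsBetween n a b := by
  refine ⟨?_, by simp [bucketsBetween]⟩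
  ext c
  simp [bucketsBetween, Fin.ext_iff]
  omega

theorem bucketsBetween_card {n a b : ℕ} (hab : a ≤ b) (hb : b ≤ n) :
    (bucketsBetween n a b).card = b - a := by
  induction b, hab using Nat.le_induction with
  | base => simp [bucketsBetween_self]
  | succ b hab ih =>
    obtain ⟨h₁, h₂⟩ := bucketsBetween_succ hab hb
    rw [h₁, Finset.card_insert_of_notMem h₂, ih (by omega)]
    omega

/-- Unrolled, the recursion makes the queue length a maximum, over starting times `a ≤ b`, of the
net inflow from `a` to `b`. The exponential of a maximum is at most the sum of the exponentials. -/
theorem exp_queueLen_le {t : ℝ} (T : Fin P.B → Fin P.D → Fin P.B) (j : Fin P.B)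
    {b : ℕ} (hb : b ≤ P.B) :
    Real.exp (t * queueLen P T j b) ≤
      ∑ a ∈ Finset.range (b + 1), ∏ c ∈ bucketsBetween P.B a b, weight P t j (T c) := by
  induction b with
  | zero => simp [queueLen, bucketsBetween_self]
  | succ b ih =>
    have hb' : b < P.B := hb
    -- The new starting time contributes an empty product, the `1` that covers an emptied queue.
    rw [Finset.sum_range_succ, bucketsBetween_self, Finset.prod_empty]
    have hs : ∑ a ∈ Finset.range (b + 1),
          ∏ c ∈ bucketsBetween P.B a (b + 1), weight P t j (T c) =
        weight P t j (T ⟨b, hb'⟩) * ∑ a ∈ Finset.range (b + 1),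
          ∏ c ∈ bucketsBetween P.B a b, weight P t j (T c) := by
      rw [Finset.mul_sum]
      refine Finset.sum_congr rfl fun a ha => ?_
      obtain ⟨h₁, h₂⟩ := bucketsBetween_succ
        (Nat.lt_succ_iff.1 (Finset.mem_range.1 ha)) hb'
      rw [h₁, Finset.prod_insert h₂]
    rw [hs]
    have hw : 0 < weight P t j (T ⟨b, hb'⟩) := Real.exp_pos _
    have ih' := mul_le_mul_of_nonneg_left (ih hb'.le) hw.le
    have hstep : Real.exp (t * queueLen P T j (b + 1)) ≤
        weight P t j (T ⟨b, hb'⟩) * Real.exp (t * queueLen P T j b) + 1 := by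
      rw [queueLen, dif_pos hb']
      rcases le_total P.C (queueLen P T j b + targetCount P (T ⟨b, hb'⟩) j) with h | h
      · rw [Nat.cast_sub h, weight, ← Real.exp_add]
        push_cast
        refine le_trans (le_of_eq ?_) (le_add_of_nonneg_right zero_le_one)
        congr 1
        ring
      · rw [Nat.sub_eq_zero_of_le h]
        simp only [Nat.cast_zero, mul_zero, Real.exp_zero]
        have := mul_pos hw (Real.exp_pos (t * queueLen P T j b))
        linarith
    linarith

theorem sum_exp_queueLen_le (hB : 0 < P.B) (hD : 0 < P.D) {t : ℝ}
    (hexp : Real.exp t < 1 + (t * P.C - Real.log 2) * P.B / P.D) (j : Fin P.B)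
    {b : ℕ} (hb : b ≤ P.B) :
    ∑ T, Real.exp (t * queueLen P T j b) ≤ (P.B : ℝ) ^ P.N * 2 := by
  refine (Finset.sum_le_sum fun T _ => exp_queueLen_le T j hb).trans ?_
  rw [Finset.sum_comm]
  refine (Finset.sum_le_sum fun a _ =>
    sum_prod_weight_le hB hD hexp j (bucketsBetween P.B a b)).trans ?_
  rw [← Finset.mul_sum]
  refine mul_le_mul_of_nonneg_left ?_ (by positivity)
  have : ∑ a ∈ Finset.range (b + 1), (1 / 2 : ℝ) ^ (bucketsBetween P.B a b).card =
      ∑ a ∈ Finset.range (b + 1), (1 / 2 : ℝ) ^ a := by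
    rw [← Finset.sum_range_reflect]
    refine Finset.sum_congr rfl fun a ha => ?_
    have := Finset.mem_range.1 ha
    rw [bucketsBetween_card (by omega) hb]
    congr 1
    omega
  rw [this]
  exact sum_geometric_two_le _

theorem card_queueLen_ge_le (hB : 0 < P.B) (hD : 0 < P.D) {t : ℝ} (ht : 0 ≤ t)
    (hexp : Real.exp t < 1 + (t * P.C - Real.log 2) * P.B / P.D) (j : Fin P.B)
    {b : ℕ} (hb : b ≤ P.B) (r : ℝ) :
    ((Finset.univ.filter fun T : Fin P.B → Fin P.D → Fin P.B =>
      r ≤ (queueLen P T j b : ℝ)).card : ℝ) ≤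
      (P.B : ℝ) ^ P.N * Real.exp (t * (2 * P.C - r)) := by
  have hB' : (0 : ℝ) < P.B := by exact_mod_cast hB
  have hD' : (0 : ℝ) < P.D := by exact_mod_cast hD
  -- Since `e^t ≥ 1`, the condition on `e^t` forces `t C > log 2`; so the factor `2` from the
  -- geometric series is absorbed in `exp (2 t C)`.
  have hlog : Real.log 2 ≤ t * P.C := by
    have h₁ : 1 ≤ Real.exp t := Real.one_le_exp ht
    have h₂ : 0 < (t * P.C - Real.log 2) * P.B / P.D := by linarith
    rw [div_pos_iff_of_pos_right hD', mul_pos_iff_of_pos_right hB'] at h₂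
    linarith
  have hlog₀ : 0 ≤ Real.log 2 := Real.log_nonneg one_le_two
  refine (card_le_of_sum_exp_le _ r t _ ht (sum_exp_queueLen_le hB hD hexp j hb)).trans ?_
  rw [mul_assoc]
  refine mul_le_mul_of_nonneg_left ?_ (by positivity)
  rw [← Real.exp_log two_pos, ← Real.exp_add, Real.exp_le_exp, Real.exp_log two_pos]
  linarith

end Tails

/-! ### Union bound for the failure probability -/

section Failure

variable {P : Params}

theorem hits_compl (T : Fin P.B → Fin P.D → Fin P.B) (A : Finset (Fin P.B)) :
    hits T A + hits T Aᶜ = P.N := by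
  rw [← hits_univ T, hits, hits, hits, ← Finset.sum_add_distrib]
  refine Finset.sum_congr rfl fun b _ => ?_
  simp only [Finset.mem_compl, Finset.mem_univ]
  rw [Finset.card_filter_add_card_filter_not, Finset.filter_true]

theorem card_lt_succ {n : ℕ} (b : Fin n) :
    (Finset.univ.filter fun j : Fin n => (j : ℕ) < b + 1).card = b + 1 := by
  have := bucketsBetween_card (n := n) (Nat.zero_le (b + 1)) b.2
  simpa [bucketsBetween] using this

theorem card_run_eq_none_le {α : Type*} (hB : 0 < P.B) (hD : 0 < P.D)
    (hK : (P.S : ℝ) / P.B ≤ P.K) (hW : P.W ≤ P.B) {t : ℝ} (ht : 0 ≤ t)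
    (hexp : Real.exp t < 1 + (t * P.C - Real.log 2) * P.B / P.D) (input : Fin P.N → α)
    [DecidableEq α] :
    ((Finset.univ.filter fun ω : Coins P => run P ω input = none).card : ℝ) ≤
      Fintype.card (Coins P) *
        ((P.B : ℝ) ^ 2 * Real.exp (t * (2 * P.C - P.S / P.B)) +
          P.B * (Real.exp (-2 * ((P.D : ℝ) * P.W) ^ 2 / P.N) +
            Real.exp (-2 * (P.Q : ℝ) ^ 2 / P.N))) := by
  classical
  set A : Fin P.B → Finset (Fin P.B) :=
    fun b => Finset.univ.filter fun j => (j : ℕ) < b + 1 with hA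
  set U : Fin P.B × Fin P.B → Finset (Fin P.B → Fin P.D → Fin P.B) := fun x =>
    Finset.univ.filter fun T => (P.S : ℝ) / P.B ≤ queueLen P T x.1 (x.2 + 1) with hU
  -- Too few items in the first buckets means too many in the others, so one upper-tail bound serves
  -- both directions.
  set V : Fin P.B → Finset (Fin P.B → Fin P.D → Fin P.B) := fun b =>
    Finset.univ.filter fun T => (P.D : ℝ) * P.W ≤ (hits T (A b)ᶜ : ℝ) - P.D * (A b)ᶜ.card with hV
  set Z : Fin P.B → Finset (Fin P.B → Fin P.D → Fin P.B) := fun b =>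
    Finset.univ.filter fun T => (P.Q : ℝ) ≤ (hits T (A b) : ℝ) - P.D * (A b).card with hZ
  -- The bad events constrain only the targets; the slot permutations stay free.
  have hsub : (Finset.univ.filter fun ω : Coins P => run P ω input = none) ⊆
      (Finset.univ.biUnion U ∪ (Finset.univ.biUnion V ∪ Finset.univ.biUnion Z)) ×ˢ
        Finset.univ := by
    rintro ⟨T, σ⟩ hω
    have hnone := (Finset.mem_filter.1 hω).2
    rw [Finset.mem_product]
    refine ⟨?_, Finset.mem_univ _⟩
    by_contra hT
    simp only [Finset.mem_union, Finset.mem_biUnion, Finset.mem_univ, true_and, not_or,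
      not_exists, hU, hV, hZ, Finset.mem_filter, not_le, Prod.forall] at hT
    obtain ⟨h₁, h₂, h₃⟩ := hT
    have hcard : ∀ b, (A b).card = b + 1 := fun b => card_lt_succ b
    obtain ⟨l, hl⟩ := run_isSome (T := T) σ input hB hK hW (fun j b => h₁ j b)
      (fun b => by
        have h := h₂ b
        have hc := hits_compl T (A b)
        have hcc := Finset.card_add_card_compl (A b)
        rw [Fintype.card_fin, hcard] at hcc
        have h' : hits T (A b)ᶜ < P.D * P.W + P.D * (A b)ᶜ.card := by
          have : (hits T (A b)ᶜ : ℝ) < P.D * P.W + P.D * (A b)ᶜ.card := by linarith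
          exact_mod_cast this
        have hN : P.N = P.D * (b + 1) + P.D * (A b)ᶜ.card := by
          rw [← mul_add, hcc, mul_comm]
        change _ ≤ hits T (A b) + _
        omega)
      (fun b => by
        have h := h₃ b
        rw [hcard] at h
        have h' : (hits T (A b) : ℝ) ≤ P.D * ((b + 1 : ℕ) : ℝ) + P.Q := by linarith
        exact_mod_cast h')
    rw [hl] at hnone
    exact absurd hnone (by simp)
  have hcoins : (Fintype.card (Coins P) : ℝ) =
      (P.B : ℝ) ^ P.N * Fintype.card (Fin P.B → Equiv.Perm (Fin P.slots)) := by
    rw [Fintype.card_prod]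
    simp [← pow_mul, mul_comm]
  set u := Real.exp (t * (2 * P.C - P.S / P.B))
  set v := Real.exp (-2 * ((P.D : ℝ) * P.W) ^ 2 / P.N)
  set z := Real.exp (-2 * (P.Q : ℝ) ^ 2 / P.N)
  have hUc : ((Finset.univ.biUnion U).card : ℝ) ≤ (P.B : ℝ) ^ 2 * ((P.B : ℝ) ^ P.N * u) := by
    refine le_trans (Nat.cast_le.2 Finset.card_biUnion_le) ?_
    rw [Nat.cast_sum]
    refine (Finset.sum_le_card_nsmul _ _ _ fun x _ =>
      card_queueLen_ge_le hB hD ht hexp x.1 x.2.2 _).trans_eq ?_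
    simp [sq, u]
  have hVc : ((Finset.univ.biUnion V).card : ℝ) ≤ P.B * ((P.B : ℝ) ^ P.N * v) := by
    refine le_trans (Nat.cast_le.2 Finset.card_biUnion_le) ?_
    rw [Nat.cast_sum]
    refine (Finset.sum_le_card_nsmul _ _ _ fun b _ =>
      card_hits_ge_le hB hD (A b)ᶜ (by positivity)).trans_eq ?_
    simp [v]
  have hZc : ((Finset.univ.biUnion Z).card : ℝ) ≤ P.B * ((P.B : ℝ) ^ P.N * z) := by
    refine le_trans (Nat.cast_le.2 Finset.card_biUnion_le) ?_
    rw [Nat.cast_sum]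
    refine (Finset.sum_le_card_nsmul _ _ _ fun b _ =>
      card_hits_ge_le hB hD (A b) (by positivity)).trans_eq ?_
    simp [z]
  have hunion : ((Finset.univ.biUnion U ∪
      (Finset.univ.biUnion V ∪ Finset.univ.biUnion Z)).card : ℝ) ≤
      (P.B : ℝ) ^ P.N * ((P.B : ℝ) ^ 2 * u + P.B * (v + z)) := by
    have h₁ : ((Finset.univ.biUnion U ∪
        (Finset.univ.biUnion V ∪ Finset.univ.biUnion Z)).card : ℝ) ≤
        (Finset.univ.biUnion U).card +
          ((Finset.univ.biUnion V).card + (Finset.univ.biUnion Z).card) := by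
      exact_mod_cast (Finset.card_union_le _ _).trans
        (Nat.add_le_add_left (Finset.card_union_le _ _) _)
    linarith
  have hprod := Finset.card_le_card hsub
  rw [Finset.card_product, Finset.card_univ] at hprod
  refine le_trans (Nat.cast_le.2 hprod) ?_
  rw [Nat.cast_mul, hcoins, mul_right_comm]
  exact mul_le_mul_of_nonneg_right hunion (Nat.cast_nonneg _)

end Failure

end StashShuffle

theorem mainTheorem1 (P : StashShuffle.Params) (hB : 0 < P.B) (hD : 0 < P.D)
    (hK : (P.S : ℝ) / P.B ≤ P.K) (hS : 2 * (P.C : ℝ) < P.S / P.B) (hW : P.W ≤ P.B)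
    (t : ℝ) (ht : t = (P.C : ℝ) * P.B / P.D - 1)
    (hexp : Real.exp t < 1 + (t * P.C - Real.log 2) * P.B / P.D)
    (input : Equiv.Perm (Fin P.N)) :
    StashShuffle.statDist (StashShuffle.outputDist P input) (StashShuffle.uniformDist P.N) ≤
      (P.B : ℝ) ^ 2 *
          Real.exp (((P.C : ℝ) * P.B / P.D - 1) * (2 * (P.C : ℝ) - (P.S : ℝ) / P.B)) +
        (P.B : ℝ) *
          (Real.exp (-2 * ((P.D : ℝ) * P.W) ^ 2 / (P.N : ℝ)) +
            Real.exp (-2 * (P.Q : ℝ) ^ 2 / (P.N : ℝ))) := by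
  have hcoins : (0 : ℝ) < Fintype.card (StashShuffle.Coins P) := by
    exact_mod_cast Fintype.card_pos
  refine (StashShuffle.statDist_le_failure P hW input).trans ?_
  rw [← ht, div_le_iff₀' hcoins]
  -- The exponential moment bound needs `t ≥ 0`. For `t < 0` both factors in the first exponent are
  -- negative, because `2 C < S / B`; the claimed bound is then at least `1`.
  rcases le_or_gt 0 t with h | h
  · exact StashShuffle.card_run_eq_none_le hB hD hK hW h hexp input
  · have h₁ : ((Finset.univ.filter fun ω : StashShuffle.Coins P =>
        StashShuffle.run P ω input = none).card : ℝ) ≤ Fintype.card (StashShuffle.Coins P) := by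
      exact_mod_cast Finset.card_le_univ _
    have hB₁ : (1 : ℝ) ≤ P.B := by exact_mod_cast hB
    have h₂ : 1 ≤ (P.B : ℝ) ^ 2 * Real.exp (t * (2 * (P.C : ℝ) - P.S / P.B)) :=
      one_le_mul_of_one_le_of_one_le (one_le_pow₀ hB₁)
        (Real.one_le_exp (mul_nonneg_of_nonpos_of_nonpos h.le (by linarith)))
    refine h₁.trans (le_mul_of_one_le_right hcoins.le (h₂.trans ?_))
    exact le_add_of_nonneg_right (by positivity)
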